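/- Let $\mathbb{F}$ be either $\mathbb{R}$ or $\mathbb{C}$, and let $A\in\mathbb{F}^{n\times n}$ and $B\in\mathbb{F}^{n\times m}$ be such that the pair $(A,B)$ is stabilizable, i.e. there is a matrix $F\in\mathbb{F}^{m\times n}$ such that every (complex) eigenvalue of $A+BF$ has negative real part. For $x_0\in\mathbb{F}^n$, let $\mathcal{U}(x_0)$ be the set of controls $u\in \mathrm{L}^2([0,\infty),\mathbb{F}^m)$ for which the solution $x$ of $\dot x(t)=Ax(t)+Bu(t)$, $x(0)=x_0$, satisfies $\lim_{t\to\infty}x(t)=0$. Then the infinite-horizon minimum energy control problem $$\min_{u\in\mathcal{U}(x_0)}\ \int_0^\infty\|u(t)\|^2\,\mathrm{d}t$$ admits a solution (that is, the minimum is attained by some $u\in\mathcal{U}(x_0)$) for every $x_0\in\mathbb{F}^n$ if and only if $A$ has no imaginary eigenvalue, i.e. no eigenvalue $\lambda\in\mathbb{C}$ with $\operatorname{Re}\lambda=0$. -/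

import Mathlib

open MeasureTheory Filter Topology Set

/-- The complex number `μ` is an eigenvalue of the square matrix `A` over `𝕜` (`ℝ` or `ℂ`),
whose entries are regarded as complex numbers. -/
def IsEigenvalue {𝕜 : Type*} [RCLike 𝕜] {n : ℕ} (A : Matrix (Fin n) (Fin n) 𝕜) (μ : ℂ) : Prop :=
  Module.End.HasEigenvalue (Matrix.toLin' (A.map (RCLike.map 𝕜 ℂ))) μ

/-- All the (complex) eigenvalues of `A` have negative real part. -/
def IsHurwitz {𝕜 : Type*} [RCLike 𝕜] {n : ℕ} (A : Matrix (Fin n) (Fin n) 𝕜) : Prop :=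
  ∀ μ : ℂ, IsEigenvalue A μ → μ.re < 0

/-- `(A, B)` is stabilizable: some feedback matrix `F` over `𝕜` makes `A + B F` Hurwitz. -/
def IsStabilizable {𝕜 : Type*} [RCLike 𝕜] {n m : ℕ}
    (A : Matrix (Fin n) (Fin n) 𝕜) (B : Matrix (Fin n) (Fin m) 𝕜) : Prop :=
  ∃ F : Matrix (Fin m) (Fin n) 𝕜, IsHurwitz (A + B * F)

/-- `x` is, on `[0, ∞)`, the (Carathéodory) solution of `x' = A x + B u`, `x(0) = x₀`: it is
locally absolutely continuous and satisfies the equation almost everywhere, that is, the right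
hand side is locally integrable and `x(t) = x₀ + ∫₀ᵗ (A x(s) + B u(s)) ds` for all `t ≥ 0`. -/
structure IsTrajectory {𝕜 : Type*} [RCLike 𝕜] {n m : ℕ}
    (A : Matrix (Fin n) (Fin n) 𝕜) (B : Matrix (Fin n) (Fin m) 𝕜)
    (x₀ : EuclideanSpace 𝕜 (Fin n)) (u : ℝ → EuclideanSpace 𝕜 (Fin m))
    (x : ℝ → EuclideanSpace 𝕜 (Fin n)) : Prop where
  intervalIntegrable : ∀ t : ℝ, 0 ≤ t → IntervalIntegrable
    (fun s => Matrix.toEuclideanLin A (x s) + Matrix.toEuclideanLin B (u s)) volume 0 t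
  eq_integral : ∀ t : ℝ, 0 ≤ t → x t = x₀ +
    ∫ s in (0 : ℝ)..t, (Matrix.toEuclideanLin A (x s) + Matrix.toEuclideanLin B (u s))

/-- The set `𝒰(x₀)` of admissible controls: those in `L²([0, ∞), 𝕜ᵐ)` whose trajectory from `x₀`
tends to `0`. A control is a function on `[0, ∞)`; its values at negative times play no role. -/
def admissibleControls {𝕜 : Type*} [RCLike 𝕜] {n m : ℕ}
    (A : Matrix (Fin n) (Fin n) 𝕜) (B : Matrix (Fin n) (Fin m) 𝕜)
    (x₀ : EuclideanSpace 𝕜 (Fin n)) : Set (ℝ → EuclideanSpace 𝕜 (Fin m)) :=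
  {u | MemLp u 2 (volume.restrict (Ici (0 : ℝ))) ∧
    ∃ x : ℝ → EuclideanSpace 𝕜 (Fin n), IsTrajectory A B x₀ u x ∧ Tendsto x atTop (𝓝 0)}

/-- The cost `η(u) = ∫₀^∞ ‖u(t)‖² dt`. -/
noncomputable def energy {𝕜 : Type*} [RCLike 𝕜] {m : ℕ} (u : ℝ → EuclideanSpace 𝕜 (Fin m)) : ℝ :=
  ∫ t in Ici (0 : ℝ), ‖u t‖ ^ 2

/-- The infinite-horizon minimum energy control problem from `x₀` admits a solution: some
admissible control attains the minimum of the cost over all the admissible controls. -/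
def HasMinimumEnergyControl {𝕜 : Type*} [RCLike 𝕜] {n m : ℕ}
    (A : Matrix (Fin n) (Fin n) 𝕜) (B : Matrix (Fin n) (Fin m) 𝕜)
    (x₀ : EuclideanSpace 𝕜 (Fin n)) : Prop :=
  ∃ u ∈ admissibleControls A B x₀, IsMinOn energy (admissibleControls A B x₀) u

/-! Sufficiency is a Hilbert space projection. The admissible controls from `x₀` form a translate of
the subspace `nullControls` of L², and stabilizability makes this translate nonempty
(`IsStabilizable.nonempty_admissibleControls`). A minimum therefore exists once the subspace is
closed. Closedness follows from the estimate `sup ‖x‖² ≤ C · energy u` for trajectories from `0`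
that tend to `0` (`exists_forall_norm_sq_le_energy`): it turns L² convergence of controls into
uniform convergence of trajectories on the whole half-line, so the limit trajectory still tends to
`0`.

The estimate comes from `y' = c y + g` with `Re c ≠ 0`. There the derivative of `‖y‖²` controls `∫
‖y‖²` by `∫ ‖g‖²`, either because `Re c < 0` or because `y → 0` removes the boundary term at
infinity. Cayley–Hamilton reduces the matrix case to this one by peeling off linear factors of the
characteristic polynomial (`IsPrimitive.exists_integral_norm_sq_le`).

Necessity: an imaginary eigenvalue gives a free motion that leaves some `x₀ ≠ 0` and returns to it
at arbitrarily late times. Waiting until a return time `τ` and then applying an optimal `u` costs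
the same energy, and for large `τ` the delayed control is almost orthogonal to `u`, so their average
costs about half. Hence the optimal energy is `0`, and the optimal trajectory is the free motion,
which does not tend to `0`. -/

/-! ### Calculus of primitives of locally integrable functions -/

lemma AbsolutelyContinuousOnInterval.of_dist_le {X Y : Type*} [PseudoMetricSpace X]
    [PseudoMetricSpace Y] {f : ℝ → X} {g : ℝ → Y} {a b C : ℝ}
    (hg : AbsolutelyContinuousOnInterval g a b)
    (hfg : ∀ s ∈ uIcc a b, ∀ t ∈ uIcc a b, dist (f s) (f t) ≤ C * dist (g s) (g t)) :
    AbsolutelyContinuousOnInterval f a b := by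
  have hC := Tendsto.const_mul C hg
  rw [mul_zero] at hC
  refine squeeze_zero' (Eventually.of_forall fun E => Finset.sum_nonneg fun _ _ => dist_nonneg)
    ?_ hC
  have : ∀ᶠ E in totalLengthFilter ⊓ 𝓟 (disjWithin a b), E ∈ disjWithin a b :=
    eventually_inf_principal.mpr (by simp)
  filter_upwards [this] with E hE
  rw [Finset.mul_sum]
  exact Finset.sum_le_sum fun i hi => hfg _ (hE.1 i hi).1 _ (hE.1 i hi).2

/-- `y` is on `[0, ∞)` a primitive of the locally integrable function `h`. -/
def IsPrimitive {E : Type*} [NormedAddCommGroup E] [NormedSpace ℝ E] (y h : ℝ → E) : Prop :=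
  ∀ t : ℝ, 0 ≤ t → IntervalIntegrable h volume 0 t ∧ y t = y 0 + ∫ s in (0 : ℝ)..t, h s

namespace IsPrimitive

section Normed

variable {E : Type*} [NormedAddCommGroup E] [NormedSpace ℝ E] {y h : ℝ → E}

lemma sub_eq_integral (H : IsPrimitive y h) {s t : ℝ} (hs : 0 ≤ s) (ht : 0 ≤ t) :
    y t - y s = ∫ r in s..t, h r := by
  rw [(H s hs).2, (H t ht).2, add_sub_add_left_eq_sub,
    intervalIntegral.integral_interval_sub_left (H t ht).1 (H s hs).1]

lemma continuousOn (H : IsPrimitive y h) : ContinuousOn y (Ici 0) := by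
  intro t ht
  have hT : (0 : ℝ) ≤ t + 1 := by linarith [mem_Ici.1 ht]
  have h1 : ContinuousOn (fun t => y 0 + ∫ s in (0 : ℝ)..t, h s) (Icc 0 (t + 1)) := by
    refine continuousOn_const.add ?_
    have := intervalIntegral.continuousOn_primitive_interval' (H _ hT).1 left_mem_uIcc
    rwa [uIcc_of_le hT] at this
  have h2 : ContinuousOn y (Icc 0 (t + 1)) := h1.congr fun s hs => (H s hs.1).2
  refine (h2 t ⟨ht, by linarith⟩).mono_of_mem_nhdsWithin ?_
  rw [← Ici_inter_Iic]
  exact inter_mem_nhdsWithin _ (Iic_mem_nhds (by linarith))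

lemma map {F : Type*} [NormedAddCommGroup F] [NormedSpace ℝ F] [CompleteSpace E] [CompleteSpace F]
    (H : IsPrimitive y h) (L : E →L[ℝ] F) : IsPrimitive (fun t => L (y t)) (fun t => L (h t)) := by
  intro t ht
  refine ⟨⟨L.integrable_comp (H t ht).1.1, L.integrable_comp (H t ht).1.2⟩, ?_⟩
  rw [L.intervalIntegral_comp_comm (H t ht).1, ← map_add, ← (H t ht).2]

lemma congr {h' : ℝ → E} (H : IsPrimitive y h) (hh : ∀ t, 0 ≤ t → h t = h' t) :
    IsPrimitive y h' := by
  intro t ht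
  have : EqOn h h' (uIcc 0 t) := fun s hs => hh s (by rw [uIcc_of_le ht] at hs; exact hs.1)
  refine ⟨(H t ht).1.congr (this.mono uIoc_subset_uIcc), ?_⟩
  rw [(H t ht).2, intervalIntegral.integral_congr this]

lemma of_hasDerivAt [CompleteSpace E] (hy : ∀ t, HasDerivAt y (h t) t) (hh : Continuous h) :
    IsPrimitive y h := by
  intro t _
  refine ⟨hh.intervalIntegrable _ _, ?_⟩
  rw [intervalIntegral.integral_eq_sub_of_hasDerivAt (fun s _ => hy s) (hh.intervalIntegrable _ _)]
  abel

end Normed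

section Inner

variable {E : Type*} [NormedAddCommGroup E] [InnerProductSpace ℂ E] [CompleteSpace E]
  {y h : ℝ → E}

omit [CompleteSpace E] in
lemma intervalIntegrable_two_mul_re_inner (H : IsPrimitive y h) {T : ℝ} (hT : 0 ≤ T) :
    IntervalIntegrable (fun t => 2 * (inner ℂ (y t) (h t)).re) volume 0 T := by
  refine IntervalIntegrable.const_mul ?_ 2
  rw [intervalIntegrable_iff_integrableOn_Ioc_of_le hT]
  have h1 := (intervalIntegrable_iff_integrableOn_Ioc_of_le hT).1 (H T hT).1
  have hcont : ContinuousOn y (Icc 0 T) := H.continuousOn.mono Icc_subset_Ici_self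
  obtain ⟨R, hR⟩ := (isCompact_Icc.image_of_continuousOn hcont).isBounded.exists_norm_le
  refine Integrable.mono' (h1.norm.const_mul R) ?_ ?_
  · exact Complex.continuous_re.comp_aestronglyMeasurable
      (((hcont.mono Ioc_subset_Icc_self).aestronglyMeasurable measurableSet_Ioc).inner
        h1.aestronglyMeasurable)
  · refine (ae_restrict_iff' measurableSet_Ioc).2 (Eventually.of_forall fun t ht => ?_)
    refine ((Complex.abs_re_le_norm _).trans (norm_inner_le_norm _ _)).trans ?_
    exact mul_le_mul_of_nonneg_right
      (hR _ (mem_image_of_mem _ (Ioc_subset_Icc_self ht))) (norm_nonneg _)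

/-- Since `y` is differentiable only almost everywhere, this rests on the fundamental theorem of
calculus for absolutely continuous functions. -/
lemma norm_sq_sub_norm_sq (H : IsPrimitive y h) {T : ℝ} (hT : 0 ≤ T) :
    ‖y T‖ ^ 2 - ‖y 0‖ ^ 2 = ∫ t in (0 : ℝ)..T, 2 * (inner ℂ (y t) (h t)).re := by
  have hcont : ContinuousOn y (Icc 0 T) := H.continuousOn.mono Icc_subset_Ici_self
  obtain ⟨R, hR⟩ := (isCompact_Icc.image_of_continuousOn hcont).isBounded.exists_norm_le
  have hR' : ∀ t ∈ Icc 0 T, ‖y t‖ ≤ R := fun t ht => hR _ (mem_image_of_mem _ ht)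
  have hN := (H T hT).1.norm
  -- Absolute continuity is inherited from the primitive of `‖h‖`; the factor `2 * R` bounds `‖y s‖
  -- + ‖y t‖`.
  have hac : AbsolutelyContinuousOnInterval (fun t => ‖y t‖ ^ 2) 0 T := by
    refine (hN.absolutelyContinuousOnInterval_intervalIntegral left_mem_uIcc).of_dist_le
      (C := 2 * R) fun s hs t ht => ?_
    rw [uIcc_of_le hT] at hs ht
    have h1 : dist (y s) (y t) ≤ dist (∫ r in (0 : ℝ)..s, ‖h r‖) (∫ r in (0 : ℝ)..t, ‖h r‖) := by
      rw [dist_eq_norm, H.sub_eq_integral ht.1 hs.1, Real.dist_eq,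
        intervalIntegral.integral_interval_sub_left (H s hs.1).1.norm (H t ht.1).1.norm]
      exact intervalIntegral.norm_integral_le_abs_integral_norm
    have h2 : |‖y s‖ - ‖y t‖| ≤ dist (y s) (y t) := by
      rw [dist_eq_norm]; exact abs_norm_sub_norm_le _ _
    have h3 : |‖y s‖ + ‖y t‖| ≤ 2 * R := by
      rw [abs_of_nonneg (by positivity)]; linarith [hR' s hs, hR' t ht]
    rw [Real.dist_eq, show ‖y s‖ ^ 2 - ‖y t‖ ^ 2 = (‖y s‖ + ‖y t‖) * (‖y s‖ - ‖y t‖) by ring,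
      abs_mul]
    exact mul_le_mul h3 (h2.trans h1) (abs_nonneg _) ((abs_nonneg _).trans h3)
  rw [← hac.integral_deriv_eq_sub]
  refine intervalIntegral.integral_congr_ae ?_
  have hne : ∀ᵐ t : ℝ, t ≠ T := by simp [ae_iff, measure_singleton]
  filter_upwards [(H T hT).1.ae_hasDerivAt_integral, hne] with t ht htT ht'
  rw [uIoc_of_le hT] at ht'
  have hd := (ht (by rw [uIcc_of_le hT]; exact ⟨ht'.1.le, ht'.2⟩) 0 left_mem_uIcc).const_add (y 0)
  have hy : HasDerivAt y (h t) t := hd.congr_of_eventuallyEq <| by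
    filter_upwards [Ioi_mem_nhds ht'.1] with s hs using (H s (le_of_lt hs)).2
  have hin := Complex.reCLM.hasFDerivAt.comp_hasDerivAt t (hy.inner ℂ hy)
  have hre : (fun t => ‖y t‖ ^ 2) = Complex.reCLM ∘ fun t => inner ℂ (y t) (y t) := by
    funext t
    simp [inner_self_eq_norm_sq_to_K, ← Complex.ofReal_pow]
  rw [hre, hin.deriv, map_add, two_mul]
  congr 1
  rw [← inner_conj_symm, Complex.reCLM_apply, Complex.conj_re]

end Inner

end IsPrimitive

/-! ### L² and uniform estimates for linear equations -/

namespace IsPrimitive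

variable {E : Type*} [NormedAddCommGroup E] [InnerProductSpace ℂ E] [CompleteSpace E]

/-- Multiply the identity for `‖y T‖² - ‖y 0‖²` by `Re c` and absorb the cross term with `2 |Re c|
‖y‖ ‖g‖ ≤ (Re c)² ‖y‖² + ‖g‖²`. The sign of `Re c` matters only for the boundary term `Re c * ‖y
T‖²`. -/
lemma memLp_and_integral_norm_sq_le {y h g : ℝ → E} {c : ℂ} (H : IsPrimitive y h)
    (hh : ∀ t, 0 ≤ t → h t = c • y t + g t) (hg : MemLp g 2 (volume.restrict (Ici (0 : ℝ))))
    (hc : c.re ≠ 0) (hy : c.re < 0 ∨ Tendsto y atTop (𝓝 0)) :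
    MemLp y 2 (volume.restrict (Ici (0 : ℝ))) ∧
      c.re ^ 2 * ∫ t in Ici (0 : ℝ), ‖y t‖ ^ 2 ≤
        |c.re| * ‖y 0‖ ^ 2 + ∫ t in Ici (0 : ℝ), ‖g t‖ ^ 2 := by
  set G := ∫ t in Ici (0 : ℝ), ‖g t‖ ^ 2 with hG
  have hg2 : IntegrableOn (fun t => ‖g t‖ ^ 2) (Ici 0) := hg.integrable_norm_pow two_ne_zero
  -- The endpoint is cut off at `0` because nothing is known about `y` at negative times.
  have hyi : ∀ T, IntervalIntegrable (fun t => ‖y t‖ ^ 2) volume 0 (max T 0) := fun T => by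
    refine ContinuousOn.intervalIntegrable ?_
    rw [uIcc_of_le (le_max_right _ _)]
    exact (H.continuousOn.mono Icc_subset_Ici_self).norm.pow 2
  have key : ∀ T : ℝ, 0 ≤ T → c.re ^ 2 * ∫ t in (0 : ℝ)..T, ‖y t‖ ^ 2 ≤
      c.re * (‖y T‖ ^ 2 - ‖y 0‖ ^ 2) + G := by
    intro T hT
    have hyiT := hyi T
    rw [max_eq_left hT] at hyiT
    have hgi : IntervalIntegrable (fun t => ‖g t‖ ^ 2) volume 0 T := by
      rw [intervalIntegrable_iff_integrableOn_Ioc_of_le hT]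
      exact hg2.mono_set (Ioc_subset_Ioi_self.trans Ioi_subset_Ici_self)
    have hhi := H.intervalIntegrable_two_mul_re_inner hT
    have hGT : ∫ t in (0 : ℝ)..T, ‖g t‖ ^ 2 ≤ G := by
      rw [intervalIntegral.integral_of_le hT]
      exact setIntegral_mono_set hg2 (Eventually.of_forall fun t => by positivity)
        (Ioc_subset_Ioi_self.trans Ioi_subset_Ici_self).eventuallyLE
    rw [H.norm_sq_sub_norm_sq hT, ← intervalIntegral.integral_const_mul,
      ← intervalIntegral.integral_const_mul]
    refine le_trans ?_ (add_le_add_right hGT _)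
    rw [← intervalIntegral.integral_add (hhi.const_mul _) hgi]
    refine intervalIntegral.integral_mono_on hT (hyiT.const_mul _)
      ((hhi.const_mul _).add hgi) fun t ht => ?_
    have h1 : (inner ℂ (y t) (h t)).re = c.re * ‖y t‖ ^ 2 + (inner ℂ (y t) (g t)).re := by
      rw [hh t ht.1, inner_add_right, inner_smul_right, inner_self_eq_norm_sq_to_K]
      simp [← Complex.ofReal_pow]
    have h2 := ((Complex.abs_re_le_norm _).trans (norm_inner_le_norm (𝕜 := ℂ) (y t) (g t)))
    have h2' : |c.re * (inner ℂ (y t) (g t)).re| ≤ |c.re| * (‖y t‖ * ‖g t‖) := by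
      rw [abs_mul]
      exact mul_le_mul_of_nonneg_left h2 (abs_nonneg _)
    replace h2' := abs_le.1 h2'
    have h3 : (|c.re| * ‖y t‖) ^ 2 = c.re ^ 2 * ‖y t‖ ^ 2 := by rw [mul_pow, sq_abs]
    rw [h1]
    nlinarith [sq_nonneg (|c.re| * ‖y t‖ - ‖g t‖)]
  -- The slack `ε` absorbs the boundary term at `T`. Taking `ε = 1` gives integrability; arbitrary
  -- `ε` then gives the sharp bound.
  have hev : ∀ ε > 0, ∀ᶠ T in atTop, ∫ t in (0 : ℝ)..T, ‖y t‖ ^ 2 ≤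
      (|c.re| * ‖y 0‖ ^ 2 + G + ε) / c.re ^ 2 := by
    intro ε hε
    have h0 : ∀ᶠ T in atTop, c.re * ‖y T‖ ^ 2 ≤ ε := by
      rcases hy with hy | hy
      · exact Eventually.of_forall fun T => by nlinarith [sq_nonneg ‖y T‖]
      · have : Tendsto (fun T => c.re * ‖y T‖ ^ 2) atTop (𝓝 0) := by
          simpa using (hy.norm.pow 2).const_mul c.re
        exact this.eventually_le_const hε
    filter_upwards [h0, eventually_ge_atTop 0] with T hT hT0
    rw [le_div_iff₀ (by positivity)]
    nlinarith [key T hT0, neg_abs_le c.re, sq_nonneg ‖y 0‖]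
  have hint : IntegrableOn (fun t => ‖y t‖ ^ 2) (Ioi 0) := by
    refine integrableOn_Ioi_of_intervalIntegral_norm_bounded
      ((|c.re| * ‖y 0‖ ^ 2 + G + 1) / c.re ^ 2) 0 (b := fun T : ℝ => max T 0) (l := atTop)
      (fun T => ?_) (tendsto_atTop_mono (fun T => le_max_left _ _) tendsto_id) ?_
    · exact (intervalIntegrable_iff_integrableOn_Ioc_of_le (le_max_right _ _)).1 (hyi T)
    · filter_upwards [hev 1 one_pos, eventually_ge_atTop 0] with T hT hT0
      simpa [max_eq_left hT0] using hT
  have hlim := intervalIntegral_tendsto_integral_Ioi 0 hint tendsto_id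
  refine ⟨?_, ?_⟩
  · rw [memLp_two_iff_integrable_sq_norm (H.continuousOn.aestronglyMeasurable measurableSet_Ici)]
    exact (integrableOn_Ici_iff_integrableOn_Ioi).2 hint
  · rw [integral_Ici_eq_integral_Ioi]
    refine le_of_forall_pos_le_add fun ε hε => ?_
    have := le_of_tendsto hlim (hev ε hε)
    rw [le_div_iff₀ (by positivity)] at this
    linarith

-- Induction on the factors: with `N = M - c`, the function `N y` solves the same equation with
-- forcing `N g` and is annihilated by the remaining factors, while `y' = c y + (N y + g)` is the
-- scalar case. `C` depends only on `M` and the list.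
open Polynomial in
lemma exists_integral_norm_sq_le (M : E →L[ℂ] E) (l : List ℂ) (hl : ∀ c ∈ l, c.re ≠ 0) :
    ∃ C : ℝ, 0 ≤ C ∧ ∀ y g : ℝ → E, IsPrimitive y (fun t => M (y t) + g t) →
      MemLp g 2 (volume.restrict (Ici (0 : ℝ))) →
      (∀ t, 0 ≤ t → aeval M (l.map fun c => X - Polynomial.C c).prod (y t) = 0) →
      ((∀ c ∈ l, c.re < 0) ∨ Tendsto y atTop (𝓝 0)) →
      MemLp y 2 (volume.restrict (Ici (0 : ℝ))) ∧ ∫ t in Ici (0 : ℝ), ‖y t‖ ^ 2 ≤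
        C * (‖y 0‖ ^ 2 + ∫ t in Ici (0 : ℝ), ‖g t‖ ^ 2) := by
  induction l with
  | nil =>
    refine ⟨0, le_rfl, fun y g _ _ hy _ => ?_⟩
    have h0 : ∀ t ∈ Ici (0 : ℝ), y t = 0 := fun t ht => by simpa using hy t ht
    refine ⟨(memLp_congr_ae ((ae_restrict_iff' measurableSet_Ici).2
      (Eventually.of_forall h0))).2 MemLp.zero', ?_⟩
    rw [setIntegral_congr_fun (g := fun _ => (0 : ℝ)) measurableSet_Ici
      (fun t ht => by simp [h0 t ht])]
    simp
  | cons c l ih =>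
    obtain ⟨C, hC, ih⟩ := ih fun d hd => hl d (List.mem_cons_of_mem _ hd)
    have hc : c.re ≠ 0 := hl c List.mem_cons_self
    set N : E →L[ℂ] E := M - c • 1 with hN
    -- The constant comes from `‖N y + g‖² ≤ 2 ‖N y‖² + 2 ‖g‖²` in the scalar bound, with the
    -- inductive bound for `N y`.
    refine ⟨(|c.re| + 2 * C * ‖N‖ ^ 2 + 2) / c.re ^ 2, by positivity,
      fun y g H hg hy hlim => ?_⟩
    have hNle : ∀ v, ‖N v‖ ^ 2 ≤ ‖N‖ ^ 2 * ‖v‖ ^ 2 := fun v => by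
      rw [← mul_pow]; exact pow_le_pow_left₀ (norm_nonneg _) (N.le_opNorm v) 2
    have hz : IsPrimitive (fun t => N (y t)) (fun t => M (N (y t)) + N (g t)) := by
      refine (H.map (N.restrictScalars ℝ)).congr fun t _ => ?_
      simp [hN, smul_add]
      abel
    have hgN : MemLp (fun t => N (g t)) 2 (volume.restrict (Ici (0 : ℝ))) := N.comp_memLp' hg
    obtain ⟨hzL, hzle⟩ := ih (fun t => N (y t)) (fun t => N (g t)) hz hgN
      (fun t ht => by
        have := hy t ht
        rw [List.map_cons, List.prod_cons, mul_comm, map_mul] at this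
        simpa [hN, Algebra.algebraMap_eq_smul_one] using this)
      (hlim.imp (fun h d hd => h d (List.mem_cons_of_mem _ hd)) fun h => by
        simpa [Function.comp_def] using (N.continuous.tendsto 0).comp h)
    have hsum := hzL.add hg
    obtain ⟨hyL, hyle⟩ := H.memLp_and_integral_norm_sq_le (c := c)
      (g := (fun t => N (y t)) + g) (fun t _ => by simp [hN]; abel) hsum hc
      (hlim.imp (fun h => h c List.mem_cons_self) id)
    refine ⟨hyL, ?_⟩
    have hgi := hg.integrable_norm_pow two_ne_zero
    have hzi := hzL.integrable_norm_pow two_ne_zero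
    have h1 : ∫ t in Ici (0 : ℝ), ‖((fun t => N (y t)) + g) t‖ ^ 2 ≤
        2 * (∫ t in Ici (0 : ℝ), ‖N (y t)‖ ^ 2) + 2 * ∫ t in Ici (0 : ℝ), ‖g t‖ ^ 2 := by
      rw [← integral_const_mul, ← integral_const_mul,
        ← integral_add (hzi.const_mul _) (hgi.const_mul _)]
      refine integral_mono (hsum.integrable_norm_pow two_ne_zero)
        ((hzi.const_mul _).add (hgi.const_mul _)) fun t => ?_
      have := norm_add_le (N (y t)) (g t)
      simp only [Pi.add_apply]
      nlinarith [norm_nonneg (N (y t) + g t), sq_nonneg (‖N (y t)‖ - ‖g t‖)]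
    have h2 : ∫ t in Ici (0 : ℝ), ‖N (g t)‖ ^ 2 ≤ ‖N‖ ^ 2 * ∫ t in Ici (0 : ℝ), ‖g t‖ ^ 2 := by
      rw [← integral_const_mul]
      exact integral_mono (hgN.integrable_norm_pow two_ne_zero) (hgi.const_mul _) fun t => hNle _
    have hG : 0 ≤ ∫ t in Ici (0 : ℝ), ‖g t‖ ^ 2 := integral_nonneg fun t => by positivity
    have h3 := mul_le_mul_of_nonneg_left (add_le_add (hNle (y 0)) h2) hC
    rw [div_mul_eq_mul_div, le_div_iff₀ (by positivity)]
    have h4 := mul_nonneg (abs_nonneg c.re) hG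
    nlinarith [sq_nonneg ‖y 0‖]

lemma norm_sq_le {M : E →L[ℂ] E} {y g : ℝ → E} (H : IsPrimitive y (fun t => M (y t) + g t))
    (hg : MemLp g 2 (volume.restrict (Ici (0 : ℝ))))
    (hy : MemLp y 2 (volume.restrict (Ici (0 : ℝ)))) {T : ℝ} (hT : 0 ≤ T) :
    ‖y T‖ ^ 2 ≤ ‖y 0‖ ^ 2 + (2 * ‖M‖ + 1) * (∫ t in Ici (0 : ℝ), ‖y t‖ ^ 2) +
      ∫ t in Ici (0 : ℝ), ‖g t‖ ^ 2 := by
  have hgi := hg.integrable_norm_pow two_ne_zero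
  have hyi := hy.integrable_norm_pow two_ne_zero
  have h1 := H.norm_sq_sub_norm_sq hT
  have hi : IntegrableOn (fun t => (2 * ‖M‖ + 1) * ‖y t‖ ^ 2 + ‖g t‖ ^ 2) (Ici 0) :=
    (hyi.const_mul _).add hgi
  have hle : ∀ t, 2 * (inner ℂ (y t) (M (y t) + g t)).re ≤
      (2 * ‖M‖ + 1) * ‖y t‖ ^ 2 + ‖g t‖ ^ 2 := fun t => by
    have h2  := re_inner_le_norm (𝕜 := ℂ) (y t) (M (y t))
    have h3  := re_inner_le_norm (𝕜 := ℂ) (y t) (g t)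
    have h4 := mul_le_mul_of_nonneg_left (M.le_opNorm (y t)) (norm_nonneg (y t))
    simp only [RCLike.re_to_complex] at h2 h3
    rw [inner_add_right, Complex.add_re]
    nlinarith [sq_nonneg (‖y t‖ - ‖g t‖)]
  have h5 : ∫ t in (0 : ℝ)..T, 2 * (inner ℂ (y t) (M (y t) + g t)).re ≤
      ∫ t in Ici (0 : ℝ), ((2 * ‖M‖ + 1) * ‖y t‖ ^ 2 + ‖g t‖ ^ 2) := by
    have hsub : Ioc 0 T ⊆ Ici 0 := Ioc_subset_Ioi_self.trans Ioi_subset_Ici_self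
    have h6 := H.intervalIntegrable_two_mul_re_inner hT
    rw [intervalIntegrable_iff_integrableOn_Ioc_of_le hT] at h6
    rw [intervalIntegral.integral_of_le hT]
    refine le_trans (integral_mono h6 (hi.mono_set hsub) hle) ?_
    exact setIntegral_mono_set hi (Eventually.of_forall fun t => by positivity) hsub.eventuallyLE
  rw [integral_add (hyi.const_mul _) hgi, integral_const_mul] at h5
  linarith

end IsPrimitive

/-! ### Passage from `𝕜` to `ℂ` -/

section Complexification

variable {𝕜 : Type*} [RCLike 𝕜]

lemma RCLike.map_mul (a b : 𝕜) :
    RCLike.map 𝕜 ℂ (a * b) = RCLike.map 𝕜 ℂ a * RCLike.map 𝕜 ℂ b := by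
  -- The real and complex cases; in the former all imaginary parts vanish.
  rcases RCLike.I_eq_zero_or_im_I_eq_one (K := 𝕜) with h | h
  · have him : ∀ z : 𝕜, RCLike.im z = 0 := fun z => by
      rw [← RCLike.mul_im_I_ax z, h]; simp
    simp [him]
  · apply Complex.ext <;> simp

/-- The natural map `ℂ → 𝕜` is linear over `𝕜`, where `𝕜` acts on `ℂ` through `𝕜 → ℂ`. -/
lemma RCLike.map_map_mul (a : 𝕜) (z : ℂ) :
    RCLike.map ℂ 𝕜 (RCLike.map 𝕜 ℂ a * z) = a * RCLike.map ℂ 𝕜 z := by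
  rcases RCLike.I_eq_zero_or_im_I_eq_one (K := 𝕜) with h | h
  · have him : ∀ z : 𝕜, RCLike.im z = 0 := fun z => by
      rw [← RCLike.mul_im_I_ax z, h]; simp
    apply RCLike.ext <;> simp [h, him]
  · apply RCLike.ext <;> simp [h]

lemma RCLike.norm_map (a : 𝕜) : ‖RCLike.map 𝕜 ℂ a‖ = ‖a‖ := by
  rw [← sq_eq_sq₀ (norm_nonneg _) (norm_nonneg _), ← Complex.normSq_eq_norm_sq,
    ← RCLike.normSq_eq_def', RCLike.normSq_apply, Complex.normSq_apply]
  simp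

/-- The entrywise embedding of `𝕜ⁿ` into `ℂⁿ`. -/
noncomputable def complexify (𝕜 : Type*) [RCLike 𝕜] (n : ℕ) :
    EuclideanSpace 𝕜 (Fin n) →L[ℝ] EuclideanSpace ℂ (Fin n) :=
  LinearMap.toContinuousLinearMap
    { toFun := fun x => WithLp.toLp 2 fun i => RCLike.map 𝕜 ℂ (x i)
      map_add' := fun x y => by ext i; simp only [PiLp.add_apply, map_add]
      map_smul' := fun r x => by ext i; simp only [PiLp.smul_apply, map_smul]; rfl }

variable {n m : ℕ}

lemma complexify_apply (x : EuclideanSpace 𝕜 (Fin n)) (i : Fin n) :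
    complexify 𝕜 n x i = RCLike.map 𝕜 ℂ (x i) := rfl

lemma norm_complexify (x : EuclideanSpace 𝕜 (Fin n)) : ‖complexify 𝕜 n x‖ = ‖x‖ := by
  simp_rw [EuclideanSpace.norm_eq, complexify_apply, RCLike.norm_map]

lemma complexify_toEuclideanLin (A : Matrix (Fin n) (Fin m) 𝕜) (x : EuclideanSpace 𝕜 (Fin m)) :
    complexify 𝕜 n (Matrix.toEuclideanLin A x) =
      Matrix.toEuclideanLin (A.map (RCLike.map 𝕜 ℂ)) (complexify 𝕜 m x) := by
  ext i
  simp only [complexify_apply, Matrix.toLpLin_apply, Matrix.mulVec, dotProduct, map_sum,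
    RCLike.map_mul, Matrix.map_apply]

end Complexification

open Polynomial in
lemma Matrix.exists_list_eigenvalues_aeval_eq_zero {n : ℕ} (A : Matrix (Fin n) (Fin n) ℂ) :
    ∃ l : List ℂ, (∀ c ∈ l, Module.End.HasEigenvalue (Matrix.toLin' A) c) ∧
      aeval (Matrix.toEuclideanCLM (𝕜 := ℂ) A) (l.map fun c => X - C c).prod = 0 := by
  refine ⟨A.charpoly.roots.toList, fun c hc => ?_, ?_⟩
  · rw [Module.End.hasEigenvalue_iff_isRoot_charpoly, Matrix.charpoly_toLin']
    exact isRoot_of_mem_roots (Multiset.mem_toList.1 hc)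
  · have h : (A.charpoly.roots.toList.map fun c => X - C c).prod = A.charpoly := by
      rw [← Multiset.prod_coe, ← Multiset.map_coe, Multiset.coe_toList]
      exact ((IsAlgClosed.splits _).eq_prod_roots_of_monic A.charpoly_monic).symm
    rw [h]
    have := aeval_algHom_apply
      (Matrix.toEuclideanCLM (n := Fin n) (𝕜 := ℂ)).toAlgEquiv.toAlgHom A A.charpoly
    rw [Matrix.aeval_self_charpoly, map_zero] at this
    exact this

/-! ### Trajectories of the control system -/

section Trajectory

variable {𝕜 : Type*} [RCLike 𝕜] {n m : ℕ} {A : Matrix (Fin n) (Fin n) 𝕜}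
  {B : Matrix (Fin n) (Fin m) 𝕜} {x₀ y₀ : EuclideanSpace 𝕜 (Fin n)}
  {u w : ℝ → EuclideanSpace 𝕜 (Fin m)} {x y : ℝ → EuclideanSpace 𝕜 (Fin n)}

lemma isTrajectory_iff : IsTrajectory A B x₀ u x ↔ x 0 = x₀ ∧
    IsPrimitive x fun s => Matrix.toEuclideanLin A (x s) + Matrix.toEuclideanLin B (u s) := by
  constructor
  · intro h
    have h0 : x 0 = x₀ := by simpa using h.eq_integral 0 le_rfl
    exact ⟨h0, fun t ht => ⟨h.intervalIntegrable t ht, h0 ▸ h.eq_integral t ht⟩⟩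
  · rintro ⟨rfl, h⟩
    exact ⟨fun t ht => (h t ht).1, fun t ht => (h t ht).2⟩

namespace IsTrajectory

lemma apply_zero (h : IsTrajectory A B x₀ u x) : x 0 = x₀ := (isTrajectory_iff.1 h).1

lemma isPrimitive (h : IsTrajectory A B x₀ u x) :
    IsPrimitive x fun s => Matrix.toEuclideanLin A (x s) + Matrix.toEuclideanLin B (u s) :=
  (isTrajectory_iff.1 h).2

lemma congr_ae (h : IsTrajectory A B x₀ u x) (huw : u =ᵐ[volume.restrict (Ici (0 : ℝ))] w) :
    IsTrajectory A B x₀ w x := by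
  have key : ∀ t : ℝ, 0 ≤ t →
      (fun s => Matrix.toEuclideanLin A (x s) + Matrix.toEuclideanLin B (u s))
        =ᵐ[volume.restrict (uIoc 0 t)]
      (fun s => Matrix.toEuclideanLin A (x s) + Matrix.toEuclideanLin B (w s)) := by
    intro t ht
    have h1 : u =ᵐ[volume.restrict (uIoc 0 t)] w := by
      refine ae_restrict_of_ae_restrict_of_subset ?_ huw
      rw [uIoc_of_le ht]
      exact Ioc_subset_Ioi_self.trans Ioi_subset_Ici_self
    filter_upwards [h1] with s hs
    rw [hs]
  refine ⟨fun t ht => (h.intervalIntegrable t ht).congr_ae (key t ht), fun t ht => ?_⟩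
  rw [h.eq_integral t ht, intervalIntegral.integral_congr_ae_restrict (key t ht)]

lemma add (hx : IsTrajectory A B x₀ u x) (hy : IsTrajectory A B y₀ w y) :
    IsTrajectory A B (x₀ + y₀) (fun t => u t + w t) (fun t => x t + y t) := by
  have key : ∀ s, Matrix.toEuclideanLin A (x s + y s) + Matrix.toEuclideanLin B (u s + w s) =
      (Matrix.toEuclideanLin A (x s) + Matrix.toEuclideanLin B (u s)) +
        (Matrix.toEuclideanLin A (y s) + Matrix.toEuclideanLin B (w s)) := fun s => by
    simp only [map_add]; abel
  refine ⟨fun t ht => ?_, fun t ht => ?_⟩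
  · simp_rw [key]
    exact (hx.intervalIntegrable t ht).add (hy.intervalIntegrable t ht)
  · simp_rw [key]
    rw [intervalIntegral.integral_add (hx.intervalIntegrable t ht) (hy.intervalIntegrable t ht),
      hx.eq_integral t ht, hy.eq_integral t ht]
    abel

lemma smul (c : 𝕜) (hx : IsTrajectory A B x₀ u x) :
    IsTrajectory A B (c • x₀) (fun t => c • u t) (fun t => c • x t) := by
  have key : ∀ s, Matrix.toEuclideanLin A (c • x s) + Matrix.toEuclideanLin B (c • u s) =
      c • (Matrix.toEuclideanLin A (x s) + Matrix.toEuclideanLin B (u s)) := fun s => by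
    simp only [map_smul, smul_add]
  refine ⟨fun t ht => ?_, fun t ht => ?_⟩
  · simp_rw [key]
    exact (hx.intervalIntegrable t ht).smul c
  · simp_rw [key]
    rw [intervalIntegral.integral_smul, hx.eq_integral t ht, smul_add]

lemma sub (hx : IsTrajectory A B x₀ u x) (hy : IsTrajectory A B y₀ w y) :
    IsTrajectory A B (x₀ - y₀) (fun t => u t - w t) (fun t => x t - y t) := by
  simpa [sub_eq_add_neg] using hx.add (hy.smul (-1))

lemma isPrimitive_complexify (h : IsTrajectory A B x₀ u x) :
    IsPrimitive (fun t => complexify 𝕜 n (x t)) fun t =>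
      Matrix.toEuclideanCLM (𝕜 := ℂ) (A.map (RCLike.map 𝕜 ℂ)) (complexify 𝕜 n (x t)) +
        complexify 𝕜 n (Matrix.toEuclideanLin B (u t)) :=
  (h.isPrimitive.map (complexify 𝕜 n)).congr fun t _ => by
    rw [map_add, complexify_toEuclideanLin]; rfl

end IsTrajectory

lemma memLp_toEuclideanLin (hu : MemLp u 2 (volume.restrict (Ici (0 : ℝ)))) :
    MemLp (fun t => Matrix.toEuclideanLin B (u t)) 2 (volume.restrict (Ici (0 : ℝ))) :=
  (Matrix.toEuclideanLin B).toContinuousLinearMap.comp_memLp' hu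

lemma memLp_complexify (hx : MemLp x 2 (volume.restrict (Ici (0 : ℝ)))) :
    MemLp (fun t => complexify 𝕜 n (x t)) 2 (volume.restrict (Ici (0 : ℝ))) :=
  (complexify 𝕜 n).comp_memLp' hx

lemma tendsto_complexify (hx : Tendsto x atTop (𝓝 0)) :
    Tendsto (fun t => complexify 𝕜 n (x t)) atTop (𝓝 0) := by
  simpa [Function.comp_def] using ((complexify 𝕜 n).continuous.tendsto 0).comp hx

/-- Without imaginary eigenvalues, trajectories from `0` that tend to `0` are bounded by the
energy of the control. -/
lemma exists_forall_norm_sq_le_energy (B : Matrix (Fin n) (Fin m) 𝕜)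
    (hA : ∀ μ : ℂ, IsEigenvalue A μ → μ.re ≠ 0) :
    ∃ C : ℝ, 0 ≤ C ∧ ∀ u x, IsTrajectory A B 0 u x →
      MemLp u 2 (volume.restrict (Ici (0 : ℝ))) → Tendsto x atTop (𝓝 0) →
      ∀ t : ℝ, 0 ≤ t → ‖x t‖ ^ 2 ≤ C * energy u := by
  obtain ⟨l, hl, hl0⟩ :=
    Matrix.exists_list_eigenvalues_aeval_eq_zero (A.map (RCLike.map 𝕜 ℂ))
  set M := Matrix.toEuclideanCLM (𝕜 := ℂ) (A.map (RCLike.map 𝕜 ℂ))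
  obtain ⟨C, hC, hbound⟩ := IsPrimitive.exists_integral_norm_sq_le M l fun c hc => hA c (hl c hc)
  set L := (Matrix.toEuclideanLin B).toContinuousLinearMap with hL
  refine ⟨((2 * ‖M‖ + 1) * C + 1) * ‖L‖ ^ 2, by positivity, fun u x hx hu hx0 t ht => ?_⟩
  have hg := memLp_complexify (memLp_toEuclideanLin (B := B) hu)
  have H := hx.isPrimitive_complexify
  -- By Cayley–Hamilton the annihilation condition holds for every trajectory.
  obtain ⟨h1, h2⟩ := hbound _ _ H hg (fun t _ => by rw [hl0]; rfl)
    (Or.inr (tendsto_complexify hx0))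
  have h3 := H.norm_sq_le hg h1 ht
  simp only [hx.apply_zero, map_zero, norm_zero, norm_complexify] at h2 h3
  have h4 : ∫ t in Ici (0 : ℝ), ‖Matrix.toEuclideanLin B (u t)‖ ^ 2 ≤ ‖L‖ ^ 2 * energy u := by
    rw [energy, ← integral_const_mul]
    refine integral_mono ((memLp_toEuclideanLin hu).integrable_norm_pow two_ne_zero)
      ((hu.integrable_norm_pow two_ne_zero).const_mul _) fun t => ?_
    simp only [← mul_pow]
    exact pow_le_pow_left₀ (norm_nonneg _) (L.le_opNorm (u t)) 2
  have h5 := mul_le_mul_of_nonneg_left h2 (show 0 ≤ 2 * ‖M‖ + 1 by positivity)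
  have h6 := mul_le_mul_of_nonneg_left h4 (show 0 ≤ (2 * ‖M‖ + 1) * C + 1 by positivity)
  nlinarith

/-- With all real parts negative, the L² estimate needs no decay assumption. Then `‖x‖²` and its
derivative are both integrable, which forces decay. -/
lemma IsHurwitz.memLp_and_tendsto_zero (hA : IsHurwitz A)
    (hx : ∀ t, HasDerivAt x (Matrix.toEuclideanLin A (x t)) t) :
    MemLp x 2 (volume.restrict (Ici (0 : ℝ))) ∧ Tendsto x atTop (𝓝 0) := by
  obtain ⟨l, hl, hl0⟩ :=
    Matrix.exists_list_eigenvalues_aeval_eq_zero (A.map (RCLike.map 𝕜 ℂ))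
  set L := (Matrix.toEuclideanLin A).toContinuousLinearMap with hL
  have hxc : Continuous x := continuous_iff_continuousAt.2 fun t => (hx t).continuousAt
  -- The autonomous equation is treated as a control system with no inputs.
  have htraj : IsTrajectory A (0 : Matrix (Fin n) (Fin 0) 𝕜) (x 0) (fun _ => 0) x :=
    isTrajectory_iff.2 ⟨rfl, (IsPrimitive.of_hasDerivAt hx (L.continuous.comp hxc)).congr
      fun t _ => by simp⟩
  obtain ⟨C, hC, hbound⟩ := IsPrimitive.exists_integral_norm_sq_le
    (Matrix.toEuclideanCLM (𝕜 := ℂ) (A.map (RCLike.map 𝕜 ℂ))) l fun c hc => (hA c (hl c hc)).ne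
  obtain ⟨h1, -⟩ := hbound _ _ htraj.isPrimitive_complexify (by simp)
    (fun t _ => by rw [hl0]; rfl) (Or.inl fun c hc => hA c (hl c hc))
  have hx2 : MemLp x 2 (volume.restrict (Ici (0 : ℝ))) := by
    refine h1.of_le hxc.aestronglyMeasurable (Eventually.of_forall fun t => ?_)
    rw [norm_complexify]
  refine ⟨hx2, ?_⟩
  have hint : Integrable (fun t => ‖x t‖ ^ 2) (volume.restrict (Ici (0 : ℝ))) :=
    hx2.integrable_norm_pow two_ne_zero
  have hderiv : ∀ t, HasDerivAt (fun t => RCLike.re (inner 𝕜 (x t) (x t)))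
      (RCLike.re (inner 𝕜 (x t) (L (x t)) + inner 𝕜 (L (x t)) (x t))) t := fun t =>
    (RCLike.reCLM (K := 𝕜)).hasFDerivAt.comp_hasDerivAt t ((hx t).inner 𝕜 (hx t))
  have hlim := tendsto_zero_of_hasDerivAt_of_integrableOn_Ioi (a := 0) (fun t _ => hderiv t)
    (by
      refine IntegrableOn.mono_set (t := Ici 0) ?_ Ioi_subset_Ici_self
      refine Integrable.mono' (hint.const_mul (2 * ‖L‖)) ?_ (Eventually.of_forall fun t => ?_)
      · exact Continuous.aestronglyMeasurable (by fun_prop)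
      · have h2 := norm_inner_le_norm (𝕜 := 𝕜) (x t) (L (x t))
        have h3 := norm_inner_le_norm (𝕜 := 𝕜) (L (x t)) (x t)
        have h4 := mul_le_mul_of_nonneg_left (L.le_opNorm (x t)) (norm_nonneg (x t))
        refine (RCLike.norm_re_le_norm _).trans ((norm_add_le _ _).trans ?_)
        nlinarith)
    (by
      refine IntegrableOn.mono_set (t := Ici 0) ?_ Ioi_subset_Ici_self
      simp only [inner_self_eq_norm_sq]
      exact hint)
  simp only [inner_self_eq_norm_sq] at hlim
  refine tendsto_zero_iff_norm_tendsto_zero.2 ?_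
  simpa using hlim.sqrt

/-- The closed-loop control `u = F x`, with `x` the exponential solution for `A + B F`, is
admissible. -/
lemma IsStabilizable.nonempty_admissibleControls (h : IsStabilizable A B)
    (x₀ : EuclideanSpace 𝕜 (Fin n)) : (admissibleControls A B x₀).Nonempty := by
  obtain ⟨F, hF⟩ := h
  set L : EuclideanSpace 𝕜 (Fin n) →L[ℝ] EuclideanSpace 𝕜 (Fin n) :=
    (Matrix.toEuclideanLin (A + B * F)).toContinuousLinearMap.restrictScalars ℝ with hL
  set x : ℝ → EuclideanSpace 𝕜 (Fin n) := fun t => NormedSpace.exp (t • L) x₀ with hx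
  have hd : ∀ t, HasDerivAt x (L (x t)) t := fun t =>
    (hasDerivAt_exp_smul_const' L t).clm_apply (hasDerivAt_const t x₀) |>.congr_deriv (by simp [hx])
  have hxc : Continuous x := continuous_iff_continuousAt.2 fun t => (hd t).continuousAt
  obtain ⟨h2, h0⟩ := hF.memLp_and_tendsto_zero hd
  refine ⟨fun t => Matrix.toEuclideanLin F (x t), memLp_toEuclideanLin h2, x, ?_, h0⟩
  refine isTrajectory_iff.2 ⟨by simp only [hx, zero_smul ℝ L, NormedSpace.exp_zero]; rfl, ?_⟩
  refine (IsPrimitive.of_hasDerivAt hd (L.continuous.comp hxc)).congr fun t _ => ?_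
  ext i
  simp [hL, Matrix.toLpLin_apply]

end Trajectory

/-! ### Existence of a minimizer by projection -/

section Sufficiency

variable {𝕜 : Type*} [RCLike 𝕜] {n m : ℕ} {A : Matrix (Fin n) (Fin n) 𝕜}
  {B : Matrix (Fin n) (Fin m) 𝕜} {x₀ y₀ : EuclideanSpace 𝕜 (Fin n)}
  {u w : ℝ → EuclideanSpace 𝕜 (Fin m)} {x : ℝ → EuclideanSpace 𝕜 (Fin n)}

lemma energy_congr_ae (h : u =ᵐ[volume.restrict (Ici (0 : ℝ))] w) : energy u = energy w :=
  integral_congr_ae (h.mono fun t ht => by simp only [ht])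

lemma energy_nonneg (u : ℝ → EuclideanSpace 𝕜 (Fin m)) : 0 ≤ energy u :=
  integral_nonneg fun t => by positivity

lemma energy_coe (f : Lp (EuclideanSpace 𝕜 (Fin m)) 2 (volume.restrict (Ici (0 : ℝ)))) :
    energy f = ‖f‖ ^ 2 := by
  have h := L2.inner_def (𝕜 := 𝕜) f f
  simp only [inner_self_eq_norm_sq_to_K] at h
  simp only [← RCLike.ofReal_pow] at h
  rw [integral_ofReal] at h
  exact_mod_cast h.symm

lemma energy_eq_norm_toLp (hu : MemLp u 2 (volume.restrict (Ici (0 : ℝ)))) :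
    energy u = ‖hu.toLp u‖ ^ 2 := by
  rw [← energy_coe, energy_congr_ae hu.coeFn_toLp]

lemma admissibleControls_congr_ae (hu : u ∈ admissibleControls A B x₀)
    (h : u =ᵐ[volume.restrict (Ici (0 : ℝ))] w) : w ∈ admissibleControls A B x₀ := by
  obtain ⟨h1, x, hx, hx0⟩ := hu
  exact ⟨(memLp_congr_ae h).1 h1, x, hx.congr_ae h, hx0⟩

lemma add_mem_admissibleControls (hu : u ∈ admissibleControls A B x₀)
    (hw : w ∈ admissibleControls A B y₀) :
    (fun t => u t + w t) ∈ admissibleControls A B (x₀ + y₀) := by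
  obtain ⟨h1, x, hx, hx0⟩ := hu
  obtain ⟨h2, y, hy, hy0⟩ := hw
  exact ⟨h1.add h2, _, hx.add hy, by simpa using hx0.add hy0⟩

lemma smul_mem_admissibleControls (c : 𝕜) (hu : u ∈ admissibleControls A B x₀) :
    (fun t => c • u t) ∈ admissibleControls A B (c • x₀) := by
  obtain ⟨h1, x, hx, hx0⟩ := hu
  exact ⟨h1.const_smul c, _, hx.smul c, by simpa using hx0.const_smul c⟩

lemma sub_mem_admissibleControls (hu : u ∈ admissibleControls A B x₀)
    (hw : w ∈ admissibleControls A B y₀) :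
    (fun t => u t - w t) ∈ admissibleControls A B (x₀ - y₀) := by
  simpa [sub_eq_add_neg] using
    add_mem_admissibleControls hu (smul_mem_admissibleControls (-1) hw)

/-- The square integrable controls that steer `0` to `0` in infinite time. -/
def nullControls (A : Matrix (Fin n) (Fin n) 𝕜) (B : Matrix (Fin n) (Fin m) 𝕜) :
    Submodule 𝕜 (Lp (EuclideanSpace 𝕜 (Fin m)) 2 (volume.restrict (Ici (0 : ℝ)))) where
  carrier := {f | ⇑f ∈ admissibleControls A B 0}
  add_mem' {f g} hf hg := by
    have := add_mem_admissibleControls hf hg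
    rw [add_zero] at this
    exact admissibleControls_congr_ae this (Lp.coeFn_add f g).symm
  zero_mem' := by
    refine admissibleControls_congr_ae (u := fun _ => 0) ⟨by simp, fun _ => 0, ?_,
      tendsto_const_nhds⟩ (Lp.coeFn_zero _ _ _).symm
    exact ⟨by simp, by simp⟩
  smul_mem' c f hf := by
    have := smul_mem_admissibleControls c hf
    rw [smul_zero] at this
    exact admissibleControls_congr_ae this (Lp.coeFn_smul c f).symm

lemma MeasureTheory.MemLp.intervalIntegrable_of_nonneg
    (hu : MemLp u 2 (volume.restrict (Ici (0 : ℝ)))) {t : ℝ} (ht : 0 ≤ t) :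
    IntervalIntegrable u volume 0 t := by
  rw [intervalIntegrable_iff_integrableOn_Ioc_of_le ht]
  exact (hu.mono_measure (Measure.restrict_mono
    (Ioc_subset_Ioi_self.trans Ioi_subset_Ici_self) le_rfl)).integrable one_le_two

/-- In this form the equation passes to limits: only the integrals of `x` and `u` over bounded
intervals have to converge. -/
lemma isTrajectory_iff_of_continuousOn (hu : MemLp u 2 (volume.restrict (Ici (0 : ℝ))))
    (hx : ContinuousOn x (Ici 0)) :
    IsTrajectory A B x₀ u x ↔ ∀ t : ℝ, 0 ≤ t → x t = x₀ +
      (Matrix.toEuclideanLin A (∫ s in (0 : ℝ)..t, x s) +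
        Matrix.toEuclideanLin B (∫ s in (0 : ℝ)..t, u s)) := by
  set L := (Matrix.toEuclideanLin A).toContinuousLinearMap with hL
  set N := (Matrix.toEuclideanLin B).toContinuousLinearMap with hN
  have hxi : ∀ t : ℝ, 0 ≤ t → IntervalIntegrable x volume 0 t := fun t ht =>
    ContinuousOn.intervalIntegrable (hx.mono (by rw [uIcc_of_le ht]; exact Icc_subset_Ici_self))
  have hui : ∀ t : ℝ, 0 ≤ t → IntervalIntegrable u volume 0 t := fun t ht =>
    hu.intervalIntegrable_of_nonneg ht
  have hLx : ∀ t : ℝ, 0 ≤ t → IntervalIntegrable (fun s => L (x s)) volume 0 t := fun t ht =>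
    ⟨L.integrable_comp (hxi t ht).1, L.integrable_comp (hxi t ht).2⟩
  have hNu : ∀ t : ℝ, 0 ≤ t → IntervalIntegrable (fun s => N (u s)) volume 0 t := fun t ht =>
    ⟨N.integrable_comp (hui t ht).1, N.integrable_comp (hui t ht).2⟩
  have key : ∀ t : ℝ, 0 ≤ t → ∫ s in (0 : ℝ)..t, (L (x s) + N (u s)) =
      L (∫ s in (0 : ℝ)..t, x s) + N (∫ s in (0 : ℝ)..t, u s) := fun t ht => by
    rw [intervalIntegral.integral_add (hLx t ht) (hNu t ht),
      L.intervalIntegral_comp_comm (hxi t ht), N.intervalIntegral_comp_comm (hui t ht)]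
  constructor
  · intro h t ht
    exact (h.eq_integral t ht).trans (congrArg _ (key t ht))
  · intro h
    exact ⟨fun t ht => (hLx t ht).add (hNu t ht),
      fun t ht => (h t ht).trans (congrArg _ (key t ht).symm)⟩

lemma tendsto_intervalIntegral_of_tendsto_Lp
    {f : ℕ → Lp (EuclideanSpace 𝕜 (Fin m)) 2 (volume.restrict (Ici (0 : ℝ)))}
    {g : Lp (EuclideanSpace 𝕜 (Fin m)) 2 (volume.restrict (Ici (0 : ℝ)))}
    (h : Tendsto f atTop (𝓝 g)) {t : ℝ} (ht : 0 ≤ t) :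
    Tendsto (fun k => ∫ s in (0 : ℝ)..t, f k s) atTop (𝓝 (∫ s in (0 : ℝ)..t, g s)) := by
  have hsub : volume.restrict (Ioc 0 t) ≤ volume.restrict (Ici (0 : ℝ)) :=
    Measure.restrict_mono (Ioc_subset_Ioi_self.trans Ioi_subset_Ici_self) le_rfl
  simp_rw [intervalIntegral.integral_of_le ht]
  have hint : ∀ f : Lp (EuclideanSpace 𝕜 (Fin m)) 2 (volume.restrict (Ici (0 : ℝ))),
      Integrable f (volume.restrict (Ioc 0 t)) := fun f =>
    ((Lp.memLp f).mono_measure hsub).integrable one_le_two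
  refine tendsto_integral_of_L1' _ (hint g).aestronglyMeasurable
    (Eventually.of_forall fun k => hint (f k)) ?_
  have h2 := (Lp.tendsto_Lp_iff_tendsto_eLpNorm' f g).1 h
  have h3 := ENNReal.Tendsto.mul_const (b := volume.restrict (Ioc 0 t) univ ^
    (1 / (1 : ENNReal).toReal - 1 / (2 : ENNReal).toReal)) h2
    (Or.inr (ENNReal.rpow_ne_top_of_nonneg (by norm_num) (by simp)))
  rw [zero_mul] at h3
  refine tendsto_of_tendsto_of_tendsto_of_le_of_le tendsto_const_nhds h3 (fun _ => zero_le)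
    fun k => ?_
  refine (eLpNorm_le_eLpNorm_mul_rpow_measure_univ one_le_two
    ((hint (f k)).sub (hint g)).aestronglyMeasurable).trans ?_
  exact mul_le_mul_left (eLpNorm_mono_measure _ hsub) _

/-- The energy bound applied to differences makes the trajectories Cauchy uniformly on `[0, ∞)`.
Uniformity up to infinity is what preserves the limit `0`. -/
lemma isClosed_nullControls (hA : ∀ μ : ℂ, IsEigenvalue A μ → μ.re ≠ 0) :
    IsClosed (nullControls A B : Set (Lp (EuclideanSpace 𝕜 (Fin m)) 2
      (volume.restrict (Ici (0 : ℝ))))) := by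
  obtain ⟨C, hC, hbound⟩ := exists_forall_norm_sq_le_energy B hA
  refine IsSeqClosed.isClosed fun f g hf hfg => ?_
  choose hfL x hx hx0 using hf
  have hdist : ∀ k l (t : ℝ), 0 ≤ t → ‖x k t - x l t‖ ≤ √C * ‖f k - f l‖ := fun k l t ht => by
    have h1 := hbound (fun t => f k t - f l t) (fun t => x k t - x l t)
      (by simpa using (hx k).sub (hx l)) ((hfL k).sub (hfL l))
      (by simpa using (hx0 k).sub (hx0 l)) t ht
    have h2 : energy (fun t => f k t - f l t) = ‖f k - f l‖ ^ 2 := by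
      rw [← energy_coe]
      exact energy_congr_ae (Lp.coeFn_sub _ _).symm
    rw [h2, ← Real.sq_sqrt hC, ← mul_pow] at h1
    exact le_of_sq_le_sq h1 (by positivity)
  have hcauchy : ∀ t : ℝ, 0 ≤ t → CauchySeq fun k => x k t := fun t ht => by
    have hf := hfg.cauchySeq
    rw [Metric.cauchySeq_iff] at hf ⊢
    intro ε hε
    -- The `+ 1` covers the case `C = 0`.
    obtain ⟨N, hN⟩ := hf (ε / (√C + 1)) (by positivity)
    refine ⟨N, fun k hk l hl => ?_⟩
    have h1 := hN k hk l hl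
    rw [lt_div_iff₀ (by positivity), dist_eq_norm] at h1
    rw [dist_eq_norm]
    nlinarith [hdist k l t ht, norm_nonneg (f k - f l), Real.sqrt_nonneg C]
  choose! y hy using fun t ht => cauchySeq_tendsto_of_complete (hcauchy t ht)
  set D : ℕ → ℝ := fun k => √C * ‖f k - g‖ with hD
  have hD0 : Tendsto D atTop (𝓝 0) := by
    simpa using (tendsto_iff_norm_sub_tendsto_zero.1 hfg).const_mul √C
  have hxy : ∀ k (t : ℝ), 0 ≤ t → ‖x k t - y t‖ ≤ D k := fun k t ht =>
    le_of_tendsto_of_tendsto' ((tendsto_const_nhds.sub (hy t ht)).norm)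
      (((tendsto_const_nhds.sub hfg).norm).const_mul _) fun l => hdist k l t ht
  have hxc : ∀ k, ContinuousOn (x k) (Ici 0) := fun k => (hx k).isPrimitive.continuousOn
  have hyc : ContinuousOn y (Ici 0) := by
    refine TendstoUniformlyOn.continuousOn (F := x) (p := atTop) ?_
      (Frequently.of_forall hxc)
    refine Metric.tendstoUniformlyOn_iff.2 fun ε hε => ?_
    filter_upwards [hD0.eventually_lt_const hε] with k hk t ht
    rw [dist_comm, dist_eq_norm]
    exact (hxy k t ht).trans_lt hk
  refine ⟨Lp.memLp g, y, ?_, ?_⟩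
  · refine (isTrajectory_iff_of_continuousOn (Lp.memLp g) hyc).2 fun t ht => ?_
    have hi : ∀ z : ℝ → EuclideanSpace 𝕜 (Fin n), ContinuousOn z (Ici 0) →
        IntervalIntegrable z volume 0 t := fun z hz =>
      ContinuousOn.intervalIntegrable (hz.mono (by rw [uIcc_of_le ht]; exact Icc_subset_Ici_self))
    have h1 : Tendsto (fun k => ∫ s in (0 : ℝ)..t, x k s) atTop (𝓝 (∫ s in (0 : ℝ)..t, y s)) := by
      refine tendsto_iff_norm_sub_tendsto_zero.2 (squeeze_zero (fun _ => norm_nonneg _)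
        (fun k => ?_) (by simpa only [zero_mul] using hD0.mul_const |t - 0|))
      rw [← intervalIntegral.integral_sub (hi _ (hxc k)) (hi _ hyc)]
      refine intervalIntegral.norm_integral_le_of_norm_le_const fun s hs => ?_
      rw [uIoc_of_le ht] at hs
      exact hxy k s hs.1.le
    have h2 := tendsto_intervalIntegral_of_tendsto_Lp hfg ht
    have h3 := ((((Matrix.toEuclideanLin A).toContinuousLinearMap.continuous.tendsto _).comp
      h1).add (((Matrix.toEuclideanLin B).toContinuousLinearMap.continuous.tendsto _).comp
      h2)).const_add 0
    refine tendsto_nhds_unique (hy t ht) (h3.congr fun k => ?_)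
    exact ((isTrajectory_iff_of_continuousOn (hfL k) (hxc k)).1 (hx k) t ht).symm
  · rw [Metric.tendsto_atTop]
    intro ε hε
    obtain ⟨k, hk⟩ := (hD0.eventually_lt_const (half_pos hε)).exists
    obtain ⟨T, hT⟩ := Metric.tendsto_atTop.1 (hx0 k) (ε / 2) (half_pos hε)
    refine ⟨max T 0, fun t ht => ?_⟩
    have h1 := hT t ((le_max_left _ _).trans ht)
    have h2 := hxy k t ((le_max_right _ _).trans ht)
    rw [dist_zero_right] at h1 ⊢
    have h3 := norm_sub_norm_le (y t) (x k t)
    rw [norm_sub_rev] at h3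
    linarith

/-- If `v` is the projection of an admissible `u` onto the closed subspace `nullControls`, then `u -
v` is the minimizer, since any two admissible controls differ by a null control. -/
lemma hasMinimumEnergyControl_of_nonempty (hA : ∀ μ : ℂ, IsEigenvalue A μ → μ.re ≠ 0)
    (h : (admissibleControls A B x₀).Nonempty) : HasMinimumEnergyControl A B x₀ := by
  obtain ⟨u, hu⟩ := h
  obtain ⟨v, hv, hmin⟩ := (nullControls A B).exists_norm_eq_iInf_of_complete_subspace
    (isClosed_nullControls hA).isComplete (hu.1.toLp u)
  have hmem : (fun t => u t - v t) ∈ admissibleControls A B x₀ := by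
    simpa using sub_mem_admissibleControls hu hv
  have hae : ⇑(hu.1.toLp u - v) =ᵐ[volume.restrict (Ici (0 : ℝ))] fun t => u t - v t := by
    filter_upwards [Lp.coeFn_sub (hu.1.toLp u) v, hu.1.coeFn_toLp] with t h1 h2
    rw [h1, Pi.sub_apply, h2]
  refine ⟨_, hmem, fun w hw => ?_⟩
  rw [mem_ofPred_eq, ← energy_congr_ae hae, energy_coe, energy_eq_norm_toLp hw.1, hmin]
  have hmem' : hu.1.toLp u - hw.1.toLp w ∈ nullControls A B := by
    have h1 := sub_mem_admissibleControls hu hw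
    rw [sub_self] at h1
    refine admissibleControls_congr_ae h1 ?_
    filter_upwards [Lp.coeFn_sub (hu.1.toLp u) (hw.1.toLp w), hu.1.coeFn_toLp,
      hw.1.coeFn_toLp] with t h1 h2 h3
    rw [h1, Pi.sub_apply, h2, h3]
  refine pow_le_pow_left₀ (Real.iInf_nonneg fun _ => norm_nonneg _) ?_ 2
  refine (ciInf_le ⟨0, ?_⟩ ⟨_, hmem'⟩).trans_eq (by rw [sub_sub_cancel])
  rintro _ ⟨w, rfl⟩
  exact norm_nonneg _

end Sufficiency

/-! ### Concatenation and uniqueness of solutions -/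

lemma IsPrimitive.concat {E : Type*} [NormedAddCommGroup E] [NormedSpace ℝ E]
    {y₁ h₁ y₂ h₂ : ℝ → E} (H₁ : IsPrimitive y₁ h₁) (H₂ : IsPrimitive y₂ h₂) {τ : ℝ} (hτ : 0 ≤ τ)
    (h0 : y₂ 0 = y₁ τ) :
    IsPrimitive (fun t => if t < τ then y₁ t else y₂ (t - τ))
      (fun t => if t < τ then h₁ t else h₂ (t - τ)) := by
  set Y : ℝ → E := fun t => if t < τ then y₁ t else y₂ (t - τ) with hY
  set H : ℝ → E := fun t => if t < τ then h₁ t else h₂ (t - τ) with hH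
  have hY1 : ∀ t ≤ τ, Y t = y₁ t := fun t ht => by
    rcases ht.lt_or_eq with h | rfl
    · simp [hY, h]
    · simp [hY, h0]
  have hpast : ∀ t, 0 ≤ t → t ≤ τ → IntervalIntegrable H volume 0 t ∧
      ∫ s in (0 : ℝ)..t, H s = ∫ s in (0 : ℝ)..t, h₁ s := fun t ht htτ => by
    have hae : h₁ =ᵐ[volume.restrict (uIoc 0 t)] H := by
      refine (ae_restrict_iff' measurableSet_uIoc).2 ?_
      have hne : ∀ᵐ s : ℝ, s ≠ τ := by simp [ae_iff, measure_singleton]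
      filter_upwards [hne] with s hs hst
      rw [uIoc_of_le ht] at hst
      simp [hH, lt_of_le_of_ne (hst.2.trans htτ) hs]
    exact ⟨(H₁ t ht).1.congr_ae hae, (intervalIntegral.integral_congr_ae_restrict hae).symm⟩
  intro t ht
  rw [hY1 0 hτ]
  rcases le_total t τ with htτ | htτ
  · refine ⟨(hpast t ht htτ).1, ?_⟩
    rw [(hpast t ht htτ).2, hY1 t htτ]
    exact (H₁ t ht).2
  · have heq : EqOn (fun s => h₂ (s - τ)) H (uIcc τ t) := fun s hs => by
      rw [uIcc_of_le htτ] at hs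
      simp [hH, not_lt.2 hs.1]
    have hi : IntervalIntegrable (fun s => h₂ (s - τ)) volume τ t := by
      have := (H₂ (t - τ) (sub_nonneg.2 htτ)).1.comp_sub_right τ
      simpa using this
    have hi' : IntervalIntegrable H volume τ t := hi.congr (heq.mono uIoc_subset_uIcc)
    refine ⟨(hpast τ hτ le_rfl).1.trans hi', ?_⟩
    rw [← intervalIntegral.integral_add_adjacent_intervals (hpast τ hτ le_rfl).1 hi',
      (hpast τ hτ le_rfl).2, ← intervalIntegral.integral_congr heq,
      intervalIntegral.integral_comp_sub_right, sub_self, ← add_assoc, ← (H₁ τ hτ).2, ← h0,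
      ← (H₂ (t - τ) (sub_nonneg.2 htτ)).2]
    simp [hY, not_lt.2 htτ]

lemma IsPrimitive.eq_zero_of_eq_clm_apply {E : Type*} [NormedAddCommGroup E] [NormedSpace ℝ E]
    [CompleteSpace E] {y : ℝ → E} (L : E →L[ℝ] E) (H : IsPrimitive y fun t => L (y t))
    (h0 : y 0 = 0) {t : ℝ} (ht : 0 ≤ t) : y t = 0 := by
  -- The constant extension to negative times is continuous on `ℝ`; right derivatives suffice for
  -- uniqueness.
  set z : ℝ → E := fun t => y (max t 0) with hz
  have hzc : Continuous z := H.continuousOn.comp_continuous (by fun_prop)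
    fun t => mem_Ici.2 (le_max_right _ _)
  have hzy : ∀ t, 0 ≤ t → z t = y t := fun t ht => by simp [hz, ht]
  have hLz : Continuous fun t => L (z t) := L.continuous.comp hzc
  have hzi : ∀ t, 0 ≤ t → z t = ∫ s in (0 : ℝ)..t, L (z s) := fun t ht => by
    rw [hzy t ht, (H t ht).2, h0, zero_add]
    refine intervalIntegral.integral_congr fun s hs => ?_
    rw [uIcc_of_le ht] at hs
    simp only [hzy s hs.1]
  have hd : ∀ s ∈ Ico 0 t, HasDerivWithinAt z (L (z s)) (Ici s) s := fun s hs =>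
    ((hLz.integral_hasStrictDerivAt 0 s).hasDerivAt.hasDerivWithinAt).congr
      (fun r hr => hzi r (hs.1.trans hr)) (hzi s hs.1)
  have := ODE_solution_unique (v := fun _ => L) (g := fun _ => (0 : E)) (fun _ => L.lipschitz)
    hzc.continuousOn hd continuousOn_const
    (fun s _ => by simpa using hasDerivWithinAt_const s (Ici s) (0 : E))
    (by rw [hzy 0 le_rfl, h0]) (right_mem_Icc.2 ht)
  rwa [hzy t ht] at this

/-! ### Imaginary eigenvalues preclude a minimum -/

section Necessity

variable {𝕜 : Type*} [RCLike 𝕜] {n m : ℕ} {A : Matrix (Fin n) (Fin n) 𝕜}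
  {B : Matrix (Fin n) (Fin m) 𝕜} {x₀ : EuclideanSpace 𝕜 (Fin n)}
  {u w : ℝ → EuclideanSpace 𝕜 (Fin m)} {x y : ℝ → EuclideanSpace 𝕜 (Fin n)}

lemma IsTrajectory.concat (hy : IsTrajectory A B x₀ w y) {τ : ℝ} (hτ : 0 ≤ τ)
    (hx : IsTrajectory A B (y τ) u x) :
    IsTrajectory A B x₀ (fun t => if t < τ then w t else u (t - τ))
      (fun t => if t < τ then y t else x (t - τ)) := by
  refine isTrajectory_iff.2 ⟨?_, (hy.isPrimitive.concat hx.isPrimitive hτ hx.apply_zero).congr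
    fun t _ => by split_ifs <;> rfl⟩
  rcases hτ.lt_or_eq with h | rfl
  · simp [h, hy.apply_zero]
  · simp [hx.apply_zero, hy.apply_zero]

lemma IsTrajectory.eq_of_same_control (hx : IsTrajectory A B x₀ u x) (hy : IsTrajectory A B x₀ u y)
    {t : ℝ} (ht : 0 ≤ t) : x t = y t := by
  have h := hx.sub hy
  refine sub_eq_zero.1 (IsPrimitive.eq_zero_of_eq_clm_apply (y := fun t => x t - y t)
    ((Matrix.toEuclideanLin A).toContinuousLinearMap.restrictScalars ℝ)
    (h.isPrimitive.congr fun t _ => by simp) (by simp [hx.apply_zero, hy.apply_zero]) ht)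

lemma measurePreserving_sub_right_restrict_Ici (τ : ℝ) :
    MeasurePreserving (fun t : ℝ => t - τ) (volume.restrict (Ici τ))
      (volume.restrict (Ici (0 : ℝ))) := by
  have h := (measurePreserving_sub_right volume τ).restrict_preimage
    (measurableSet_Ici (a := (0 : ℝ)))
  simpa using h

lemma memLp_delay (hu : MemLp u 2 (volume.restrict (Ici (0 : ℝ)))) {τ : ℝ} (hτ : 0 ≤ τ) :
    MemLp ((Ici τ).indicator fun t => u (t - τ)) 2 (volume.restrict (Ici (0 : ℝ))) := by
  rw [memLp_indicator_iff_restrict measurableSet_Ici,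
    Measure.restrict_restrict measurableSet_Ici, inter_eq_left.2 (Ici_subset_Ici.2 hτ)]
  exact hu.comp_measurePreserving (measurePreserving_sub_right_restrict_Ici τ)

lemma energy_delay (u : ℝ → EuclideanSpace 𝕜 (Fin m)) {τ : ℝ} (hτ : 0 ≤ τ) :
    energy ((Ici τ).indicator fun t => u (t - τ)) = energy u := by
  have h1 : ∀ t, ‖(Ici τ).indicator (fun t => u (t - τ)) t‖ ^ 2 =
      (Ici τ).indicator (fun t => ‖u (t - τ)‖ ^ 2) t := fun t => by
    by_cases h : t ∈ Ici τ <;> simp [h]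
  rw [energy, energy]
  simp_rw [h1]
  rw [integral_indicator measurableSet_Ici, Measure.restrict_restrict measurableSet_Ici,
    inter_eq_left.2 (Ici_subset_Ici.2 hτ)]
  exact (measurePreserving_sub_right_restrict_Ici τ).integral_comp
    (MeasurableEquiv.subRight τ).measurableEmbedding fun t => ‖u t‖ ^ 2

lemma tendsto_integral_tail (hu : MemLp u 2 (volume.restrict (Ici (0 : ℝ)))) :
    Tendsto (fun τ => ∫ t in Ici (0 : ℝ), (Ici τ).indicator (fun t => ‖u t‖ ^ 2) t) atTop
      (𝓝 0) := by
  have hi : Integrable (fun t => ‖u t‖ ^ 2) (volume.restrict (Ici (0 : ℝ))) :=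
    hu.integrable_norm_pow two_ne_zero
  have h := tendsto_integral_filter_of_dominated_convergence
    (μ := volume.restrict (Ici (0 : ℝ))) (l := atTop)
    (F := fun τ : ℝ => (Ici τ).indicator fun t => ‖u t‖ ^ 2) (f := fun _ => 0)
    (fun t => ‖u t‖ ^ 2)
    (Eventually.of_forall fun τ => hi.aestronglyMeasurable.indicator measurableSet_Ici)
    (Eventually.of_forall fun τ => Eventually.of_forall fun t =>
      (norm_indicator_le_norm_self _ _).trans_eq (by simp)) hi
    (Eventually.of_forall fun t => tendsto_const_nhds.congr' <| by
      filter_upwards [eventually_gt_atTop t] with τ hτ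
      simp [hτ])
  rwa [integral_zero] at h

/-- If the free motion from `x₀` returns to `x₀` at arbitrarily late times, delaying a control
produces nearly orthogonal controls of equal energy, so that a minimal energy has to vanish. -/
lemma eq_zero_of_hasMinimumEnergyControl_of_recurrent (hmin : HasMinimumEnergyControl A B x₀)
    (hy : IsTrajectory A B x₀ (fun _ => 0) y) (hrec : ∀ N : ℝ, ∃ τ ≥ N, y τ = x₀) : x₀ = 0 := by
  obtain ⟨u, ⟨hu, x, hx, hx0⟩, hmin⟩ := hmin
  have hui : Integrable (fun t => ‖u t‖ ^ 2) (volume.restrict (Ici (0 : ℝ))) :=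
    hu.integrable_norm_pow two_ne_zero
  have hle : ∀ τ : ℝ, 0 ≤ τ → y τ = x₀ →
      3 * energy u ≤ 4 * ∫ t in Ici (0 : ℝ), (Ici τ).indicator (fun t => ‖u t‖ ^ 2) t := by
    intro τ hτ hyτ
    set v := (Ici τ).indicator fun t => u (t - τ) with hv
    have hvL : MemLp v 2 (volume.restrict (Ici (0 : ℝ))) := memLp_delay hu hτ
    have hvi : Integrable (fun t => ‖v t‖ ^ 2) (volume.restrict (Ici (0 : ℝ))) :=
      hvL.integrable_norm_pow two_ne_zero
    have hvmem : v ∈ admissibleControls A B x₀ := by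
      refine ⟨hvL, fun t => if t < τ then y t else x (t - τ), ?_, ?_⟩
      · have h1 := hy.concat hτ (hyτ.symm ▸ hx)
        have h2 : (fun t => if t < τ then 0 else u (t - τ)) = v := by
          funext t
          by_cases h : t < τ
          · simp [hv, h]
          · simp [hv, h, not_lt.1 h]
        rwa [h2] at h1
      · have h1 : Tendsto (fun t => x (t - τ)) atTop (𝓝 0) :=
          hx0.comp (tendsto_atTop_add_const_right _ (-τ) tendsto_id)
        refine h1.congr' ?_
        filter_upwards [eventually_ge_atTop τ] with t ht
        simp [not_lt.2 ht]
    have hwmem := smul_mem_admissibleControls (1 / 2 : 𝕜)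
      (add_mem_admissibleControls ⟨hu, x, hx, hx0⟩ hvmem)
    rw [← two_smul 𝕜 x₀, smul_smul, one_div, inv_mul_cancel₀ two_ne_zero, one_smul] at hwmem
    have h1 : energy u ≤ _ := hmin hwmem
    have hti : Integrable ((Ici τ).indicator fun t => ‖u t‖ ^ 2)
        (volume.restrict (Ici (0 : ℝ))) := hui.indicator measurableSet_Ici
    -- Before `τ` the delayed control `v` vanishes, so only `‖u‖² / 4` remains; after `τ` the bound
    -- is Young's inequality `(2 ‖u‖ - ‖v‖)² ≥ 0`. What matters is `1/4 + 3/8 < 1`: optimality then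
    -- bounds the energy by the tail of `u`.
    have h2 : energy (fun t => (2⁻¹ : 𝕜) • (u t + v t)) ≤ ∫ t in Ici (0 : ℝ),
        (1 / 4 * ‖u t‖ ^ 2 + 3 / 8 * ‖v t‖ ^ 2 +
          1 / 2 * (Ici τ).indicator (fun t => ‖u t‖ ^ 2) t) := by
      refine integral_mono (hwmem.1.integrable_norm_pow two_ne_zero)
        (((hui.const_mul _).add (hvi.const_mul _)).add (hti.const_mul _)) fun t => ?_
      simp only [norm_smul, norm_inv, RCLike.norm_ofNat]
      have h3 := norm_add_le (u t) (v t)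
      have h4 : ‖u t + v t‖ ^ 2 ≤ (‖u t‖ + ‖v t‖) ^ 2 := pow_le_pow_left₀ (norm_nonneg _) h3 2
      by_cases h : t ∈ Ici τ
      · rw [indicator_of_mem h]
        nlinarith [sq_nonneg (2 * ‖u t‖ - ‖v t‖)]
      · have hv0 : v t = 0 := indicator_of_notMem h _
        rw [indicator_of_notMem h]
        rw [hv0, norm_zero, add_zero]
        nlinarith
    have hsum : Integrable (fun t => 1 / 4 * ‖u t‖ ^ 2 + 3 / 8 * ‖v t‖ ^ 2)
        (volume.restrict (Ici (0 : ℝ))) := (hui.const_mul _).add (hvi.const_mul _)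
    rw [integral_add hsum (hti.const_mul _), integral_add (hui.const_mul _) (hvi.const_mul _),
      integral_const_mul, integral_const_mul,
      integral_const_mul] at h2
    have h3 : ∫ t in Ici (0 : ℝ), ‖v t‖ ^ 2 = energy u := energy_delay u hτ
    have h4 : ∫ t in Ici (0 : ℝ), ‖u t‖ ^ 2 = energy u := rfl
    rw [h3, h4] at h2
    linarith
  have henergy : energy u = 0 := by
    refine le_antisymm (le_of_forall_pos_le_add fun ε hε => ?_) (energy_nonneg u)
    obtain ⟨N, hN⟩ :=
      eventually_atTop.1 ((tendsto_integral_tail hu).eventually_lt_const (half_pos hε))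
    obtain ⟨τ, hτ, hyτ⟩ := hrec (max N 0)
    have h1 := hN τ ((le_max_left _ _).trans hτ)
    have h2 := hle τ ((le_max_right _ _).trans hτ) hyτ
    linarith [energy_nonneg u]
  have hae : u =ᵐ[volume.restrict (Ici (0 : ℝ))] fun _ => 0 := by
    have h1 := (integral_eq_zero_iff_of_nonneg (fun t => by positivity) hui).1 henergy
    filter_upwards [h1] with t ht
    simpa using ht
  have hxy : ∀ t : ℝ, 0 ≤ t → x t = y t := fun t ht => (hx.congr_ae hae).eq_of_same_control hy ht
  by_contra hne
  obtain ⟨N, hN⟩ := eventually_atTop.1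
    ((tendsto_zero_iff_norm_tendsto_zero.1 hx0).eventually_lt_const (norm_pos_iff.2 hne))
  obtain ⟨τ, hτ, hyτ⟩ := hrec (max N 0)
  have h1 := hN τ ((le_max_left _ _).trans hτ)
  rw [hxy τ ((le_max_right _ _).trans hτ), hyτ] at h1
  exact lt_irrefl _ h1

/-- The entrywise natural map from `ℂⁿ` to `𝕜ⁿ`. -/
noncomputable def decomplexify (𝕜 : Type*) [RCLike 𝕜] (n : ℕ) :
    EuclideanSpace ℂ (Fin n) →L[ℝ] EuclideanSpace 𝕜 (Fin n) :=
  LinearMap.toContinuousLinearMap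
    { toFun := fun z => WithLp.toLp 2 fun i => RCLike.map ℂ 𝕜 (z i)
      map_add' := fun x y => by ext i; simp only [PiLp.add_apply, map_add]
      map_smul' := fun r x => by ext i; simp only [PiLp.smul_apply, map_smul]; rfl }

lemma decomplexify_apply (z : EuclideanSpace ℂ (Fin n)) (i : Fin n) :
    decomplexify 𝕜 n z i = RCLike.map ℂ 𝕜 (z i) := rfl

lemma decomplexify_toEuclideanLin (A : Matrix (Fin n) (Fin n) 𝕜) (z : EuclideanSpace ℂ (Fin n)) :
    decomplexify 𝕜 n (Matrix.toEuclideanLin (A.map (RCLike.map 𝕜 ℂ)) z) =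
      Matrix.toEuclideanLin A (decomplexify 𝕜 n z) := by
  ext i
  simp only [decomplexify_apply, Matrix.toLpLin_apply, Matrix.mulVec, dotProduct, map_sum,
    RCLike.map_map_mul, Matrix.map_apply]

/-- For `𝕜 = ℝ` the map takes real parts and may kill an eigenvector; it cannot kill both `z` and `I
• z`. -/
lemma exists_decomplexify_smul_ne_zero {z : EuclideanSpace ℂ (Fin n)} (hz : z ≠ 0) :
    ∃ c : ℂ, decomplexify 𝕜 n (c • z) ≠ 0 := by
  by_contra! h
  refine hz ?_
  ext i
  have hre : ∀ c : ℂ, (c * z i).re = 0 := fun c => by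
    have h1 := congrArg (fun w : EuclideanSpace 𝕜 (Fin n) => RCLike.re (w i)) (h c)
    simpa only [decomplexify_apply, PiLp.smul_apply, smul_eq_mul, RCLike.map_apply, map_add,
      RCLike.ofReal_re, RCLike.re_ofReal_mul, RCLike.I_re, mul_zero, add_zero, PiLp.zero_apply,
      map_zero, RCLike.re_to_complex] using h1
  apply Complex.ext
  · simpa using hre 1
  · simpa using hre Complex.I

lemma exists_ge_exp_mul_I_eq_one (ω N : ℝ) :
    ∃ τ ≥ N, Complex.exp ((τ : ℂ) * (ω * Complex.I)) = 1 := by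
  rcases eq_or_ne ω 0 with rfl | hω
  · exact ⟨N, le_rfl, by simp⟩
  · have hpos : 0 < 2 * Real.pi / |ω| := by positivity
    obtain ⟨k, hk⟩ := exists_nat_ge (N / (2 * Real.pi / |ω|))
    refine ⟨k * (2 * Real.pi / |ω|), (div_le_iff₀ hpos).1 hk, ?_⟩
    rw [Complex.exp_eq_one_iff]
    have hωC : (ω : ℂ) ≠ 0 := by exact_mod_cast hω
    rcases abs_choice ω with h | h
    · refine ⟨k, ?_⟩
      rw [h]; push_cast; field_simp
    · refine ⟨-k, ?_⟩
      rw [h]; push_cast; field_simp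

/-- For an eigenvector `z`, the motion `exp (t μ) • z` is periodic (constant if `μ = 0`). Its image
in `𝕜ⁿ` still solves the equation because `decomplexify` intertwines the two actions of `A`; a
scalar multiple of `z` keeps the image nonzero. -/
lemma exists_recurrent_trajectory {μ : ℂ} (B : Matrix (Fin n) (Fin m) 𝕜) (hμ : IsEigenvalue A μ)
    (hre : μ.re = 0) :
    ∃ (x₀ : EuclideanSpace 𝕜 (Fin n)) (y : ℝ → EuclideanSpace 𝕜 (Fin n)), x₀ ≠ 0 ∧
      IsTrajectory A B x₀ (fun _ => 0) y ∧ ∀ N : ℝ, ∃ τ ≥ N, y τ = x₀ := by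
  obtain ⟨v, hv⟩ := hμ.exists_hasEigenvector
  set z : EuclideanSpace ℂ (Fin n) := WithLp.toLp 2 v with hz
  have hz0 : z ≠ 0 := fun h => hv.2 (by simpa [hz] using h)
  obtain ⟨c, hc⟩ := exists_decomplexify_smul_ne_zero (𝕜 := 𝕜) hz0
  have hAz : Matrix.toEuclideanLin (A.map (RCLike.map 𝕜 ℂ)) z = μ • z := by
    have h1 := hv.apply_eq_smul
    rw [Matrix.toLin'_apply] at h1
    rw [hz, Matrix.toLpLin_toLp, Matrix.toLin'_apply, h1]; rfl
  set Y : ℝ → EuclideanSpace ℂ (Fin n) := fun t => Complex.exp (t * μ) • (c • z) with hY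
  have hYd : ∀ t : ℝ, HasDerivAt Y (Matrix.toEuclideanLin (A.map (RCLike.map 𝕜 ℂ)) (Y t)) t := by
    intro t
    have h1 : HasDerivAt (fun t : ℝ => Complex.exp (t * μ)) (Complex.exp (t * μ) * (1 * μ)) t :=
      ((Complex.ofRealCLM.hasDerivAt (x := t)).mul_const μ).cexp
    refine (h1.smul_const (c • z)).congr_deriv ?_
    simp only [hY, map_smul, hAz, smul_smul]
    congr 1
    ring
  have hyd : ∀ t : ℝ, HasDerivAt (fun t => decomplexify 𝕜 n (Y t))
      (Matrix.toEuclideanLin A (decomplexify 𝕜 n (Y t))) t := fun t => by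
    rw [← decomplexify_toEuclideanLin]
    exact (decomplexify 𝕜 n).hasFDerivAt.comp_hasDerivAt t (hYd t)
  have hyc : Continuous fun t => decomplexify 𝕜 n (Y t) :=
    continuous_iff_continuousAt.2 fun t => (hyd t).continuousAt
  refine ⟨decomplexify 𝕜 n (c • z), fun t => decomplexify 𝕜 n (Y t), hc,
    isTrajectory_iff.2 ⟨by simp [hY], ?_⟩, fun N => ?_⟩
  · exact (IsPrimitive.of_hasDerivAt hyd
      ((Matrix.toEuclideanLin A).toContinuousLinearMap.continuous.comp hyc)).congr
      fun t _ => by simp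
  · obtain ⟨τ, hτ, h⟩ := exists_ge_exp_mul_I_eq_one μ.im N
    refine ⟨τ, hτ, ?_⟩
    have hμ' : μ = μ.im * Complex.I := by apply Complex.ext <;> simp [hre]
    simp only [hY]
    rw [hμ', h, one_smul]

end Necessity

theorem theorem1 {𝕜 : Type*} [RCLike 𝕜] {n m : ℕ}
    (A : Matrix (Fin n) (Fin n) 𝕜) (B : Matrix (Fin n) (Fin m) 𝕜)
    (hAB : IsStabilizable A B) :
    (∀ x₀ : EuclideanSpace 𝕜 (Fin n), HasMinimumEnergyControl A B x₀) ↔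
      ∀ μ : ℂ, IsEigenvalue A μ → μ.re ≠ 0 := by
  refine ⟨fun h μ hμ hre => ?_, fun h x₀ =>
    hasMinimumEnergyControl_of_nonempty h (hAB.nonempty_admissibleControls x₀)⟩
  obtain ⟨x₀, y, hx₀, hy, hrec⟩ := exists_recurrent_trajectory B hμ hre
  exact hx₀ (eq_zero_of_hasMinimumEnergyControl_of_recurrent (h x₀) hy hrec)
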